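/- Let $X$ be a complex Hilbert space, $U$ a complex Banach space, and $\alpha>0$. Let $A:D(A)\subset X\to X$ be diagonalizable, i.e. the resolvent set $\varrho(A)$ is non-empty and $X$ has a Riesz basis $(\varphi_n)_{n\in\mathbb N}$ consisting of eigenvectors of $A$. Suppose that $A$ generates a $C_0$-semigroup $(T(t))_{t\ge 0}$ that is polynomially stable with parameter $\alpha$, i.e. $\sup_{t\ge0}\|T(t)\|<\infty$, $\|T(t)(I-A)^{-1}\|\to0$ and $\|T(t)A^{-1}\|=O(t^{-1/\alpha})$ as $t\to\infty$. Let $B:U\to X$ be a bounded linear operator of finite rank with $\operatorname{ran}(B)\subset D((-A)^{\alpha})$, where $(-A)^\alpha$ is the fractional power of the sectorial operator $-A$. Then the linear system $$\dot x(t)=Ax(t)+Bu(t),\quad t\ge0,\qquad x(0)=x_0,$$ with inputs $u\in L^\infty(\mathbb R_+,U)$ is polynomially input-to-state stable with parameter $\alpha$. That is: (i) for all $x_0\in X$ and $u\in L^\infty(\mathbb R_+,U)$ there is a unique mild solution $\phi(\cdot,x_0,u)\in C(\mathbb R_+,X)$, i.e. a unique continuous function with $\phi(t,x_0,u)=T(t)x_0+\int_0^tT(t-s)Bu(s)\,\mathrm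 ds$ for all $t\ge 0$; (ii) there are $\gamma,\mu\in\mathcal K_\infty$ such that $\|\phi(t,x_0,u)\|\le\gamma(\|x_0\|)+\mu(\|u\|_\infty)$ for all $x_0\in X$, $u\in L^\infty(\mathbb R_+,U)$, $t\ge0$; (iii) there are $\kappa\in\mathcal{KL}$ and $\mu\in\mathcal K_\infty$ such that $\|\phi(t,x_0,u)\|\le\kappa(\|x_0\|+\|Ax_0\|,t)+\mu(\|u\|_\infty)$ for all $x_0\in D(A)$, $u\in L^\infty(\mathbb R_+,U)$, $t\ge0$, and, for every $r>0$, $\kappa(r,t)=O(t^{-1/\alpha})$ as $t\to\infty$. Here $\mathcal K$ is the set of continuous strictly increasing $\mu:\mathbb R_+\to\mathbb R_+$ with $\mu(0)=0$, $\mathcal K_\infty$ is the set of unbounded functions in $\mathcal K$, and $\mathcal{KL}$ is the set of continuous $\kappa:\mathbb R_+\times\mathbb R_+\to\mathbb R_+$ such that $\kappa(\cdot,t)\in\mathcal K$ for every $t\ge0$ and, for every $r>0$, $\kappa(r,\cdot)$ is strictly decreasing with limit $0$ at infinity. -/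

import Mathlib

open Set Filter Topology MeasureTheory Asymptotics
open scoped NNReal ENNReal

namespace PolyISS

noncomputable section

section Comparison

/-- Class `𝒦`: continuous, strictly increasing functions on `[0,∞)` vanishing at `0`. -/
structure IsClassK (μ : ℝ≥0 → ℝ≥0) : Prop where
  continuous : Continuous μ
  strictMono : StrictMono μ
  map_zero : μ 0 = 0

/-- Class `𝒦_∞`: unbounded functions of class `𝒦`. -/
structure IsClassKInf (μ : ℝ≥0 → ℝ≥0) : Prop extends IsClassK μ where
  unbounded : ¬ BddAbove (range μ)

/-- Class `ℒ`: continuous, strictly decreasing functions on `[0,∞)` tending to `0`. -/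
structure IsClassL (μ : ℝ≥0 → ℝ≥0) : Prop where
  continuous : Continuous μ
  strictAnti : StrictAnti μ
  tendsto_zero : Tendsto μ atTop (𝓝 0)

/-- Class `𝒦ℒ`. -/
structure IsClassKL (κ : ℝ≥0 → ℝ≥0 → ℝ≥0) : Prop where
  continuous : Continuous fun p : ℝ≥0 × ℝ≥0 => κ p.1 p.2
  classK : ∀ t, IsClassK fun r => κ r t
  classL : ∀ r, 0 < r → IsClassL fun t => κ r t

end Comparison

section Operators

variable {X : Type*} [NormedAddCommGroup X] [NormedSpace ℂ X]

/-- `R` is a bounded everywhere defined two-sided inverse of `μ I - A`: for every `x`, `R x` lies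
in `D(A)` with `A (R x) = μ R x - x`, and `R (μ x - A x) = x` for `x ∈ D(A)`. -/
def IsResolventAt (A : X →ₗ.[ℂ] X) (μ : ℂ) (R : X →L[ℂ] X) : Prop :=
  (∀ x : X, (R x, μ • R x - x) ∈ A.graph) ∧
    ∀ x : A.domain, R (μ • (x : X) - A x) = x

/-- The resolvent set `ϱ(A)`. -/
def resolventSet (A : X →ₗ.[ℂ] X) : Set ℂ :=
  {μ | ∃ R : X →L[ℂ] X, IsResolventAt A μ R}

open Classical in
/-- The resolvent `R(μ, A) = (μ I - A)⁻¹` for `μ ∈ ϱ(A)` (and `0` otherwise). -/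
def resolventOp (A : X →ₗ.[ℂ] X) (μ : ℂ) : X →L[ℂ] X :=
  if h : μ ∈ resolventSet A then Classical.choose h else 0

/-- The family `(T t)_{t ≥ 0}` is a `C₀`-semigroup (values at negative times are irrelevant). -/
structure IsC0Semigroup (T : ℝ → X →L[ℂ] X) : Prop where
  map_zero : T 0 = 1
  map_add : ∀ s t : ℝ, 0 ≤ s → 0 ≤ t → T (s + t) = T s * T t
  tendsto_zero : ∀ x : X, Tendsto (fun t => T t x) (𝓝[>] 0) (𝓝 x)

/-- `A` (with its domain) is the generator of the `C₀`-semigroup `T`. -/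
structure IsGeneratorOf (A : X →ₗ.[ℂ] X) (T : ℝ → X →L[ℂ] X) : Prop where
  isC0Semigroup : IsC0Semigroup T
  mem_graph_iff : ∀ x y : X, (x, y) ∈ A.graph ↔
    Tendsto (fun t : ℝ => (t : ℂ)⁻¹ • (T t x - x)) (𝓝[>] 0) (𝓝 y)

/-- Semi-uniform stability of the semigroup `T` with generator `A`: uniform boundedness and
`‖T(t) R(1,A)‖ → 0`. -/
structure IsSemiUniformlyStable (A : X →ₗ.[ℂ] X) (T : ℝ → X →L[ℂ] X) : Prop where
  bounded : ∃ M : ℝ, ∀ t : ℝ, 0 ≤ t → ‖T t‖ ≤ M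
  one_mem : (1 : ℂ) ∈ resolventSet A
  tendsto_zero : Tendsto (fun t : ℝ => ‖T t * resolventOp A 1‖) atTop (𝓝 0)

/-- Polynomial stability with parameter `α > 0` of the semigroup `T` with generator `A`:
semi-uniform stability and `‖T(t) A⁻¹‖ = O(t^{-1/α})`, where `A⁻¹ = -R(0,A)`. -/
structure IsPolynomiallyStable (A : X →ₗ.[ℂ] X) (T : ℝ → X →L[ℂ] X) (α : ℝ) : Prop where
  pos : 0 < α
  semiUniformlyStable : IsSemiUniformlyStable A T
  zero_mem : (0 : ℂ) ∈ resolventSet A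
  isBigO : (fun t : ℝ => ‖T t * -resolventOp A 0‖) =O[atTop] fun t : ℝ => t ^ (-(1 / α))

/-- The negative fractional power `(-A)^{-α}`, `α > 0`, of an invertible sectorial operator `-A`,
by the Balakrishnan–Komatsu integral, with `n = ⌊α⌋ + 1`,
`Γ(n) / (Γ(α) Γ(n - α)) ∫₀^∞ t^{n-α-1} (t I - A)^{-n} dt`.
The integral converges in operator norm when `0 ∈ ϱ(A)` and `t ‖R(t,A)‖` is bounded for `t > 0`,
in particular when `A` generates a bounded semigroup and `0 ∈ ϱ(A)`. -/
def negPowNeg (A : X →ₗ.[ℂ] X) (α : ℝ) : X →L[ℂ] X :=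
  ((Real.Gamma (⌊α⌋₊ + 1) / (Real.Gamma α * Real.Gamma (⌊α⌋₊ + 1 - α)) : ℝ) : ℂ) •
    ∫ t in Ioi (0 : ℝ),
      ((t ^ ((⌊α⌋₊ + 1 : ℝ) - α - 1) : ℝ) : ℂ) • resolventOp A (t : ℂ) ^ (⌊α⌋₊ + 1)

/-- The fractional power `(-A)^α`, `α > 0`, of an invertible sectorial operator `-A`: the (unbounded)
inverse of the injective bounded operator `(-A)^{-α}`, with domain `ran ((-A)^{-α})`. -/
def negPow (A : X →ₗ.[ℂ] X) (α : ℝ) : X →ₗ.[ℂ] X :=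
  ((negPowNeg A α : X →ₗ[ℂ] X).toPMap ⊤).inverse

end Operators

section Diagonalizable

variable {X : Type*} [NormedAddCommGroup X] [InnerProductSpace ℂ X]

/-- A Riesz basis: the preimage of the canonical orthonormal basis of `ℓ²(ℕ)` under a bounded
linear operator with bounded inverse. -/
def IsRieszBasis (φ : ℕ → X) : Prop :=
  ∃ Q : X ≃L[ℂ] lp (fun _ : ℕ => ℂ) 2, ∀ n, Q (φ n) = lp.single 2 n (1 : ℂ)

/-- `v` is an eigenvector of the operator `A`. -/
def IsEigenvector (A : X →ₗ.[ℂ] X) (v : X) : Prop :=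
  v ≠ 0 ∧ ∃ lam : ℂ, (v, lam • v) ∈ A.graph

/-- Diagonalizable operators: nonempty resolvent set and a Riesz basis of eigenvectors. -/
def IsDiagonalizable (A : X →ₗ.[ℂ] X) : Prop :=
  (resolventSet A).Nonempty ∧ ∃ φ : ℕ → X, IsRieszBasis φ ∧ ∀ n, IsEigenvector A (φ n)

end Diagonalizable

section Systems

variable {X : Type*} [NormedAddCommGroup X] [NormedSpace ℂ X]
variable {U : Type*} [NormedAddCommGroup U] [NormedSpace ℂ U]

/-- The input space `L^∞(ℝ₊, U)`, with the essential supremum norm. -/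
abbrev Input (U : Type*) [NormedAddCommGroup U] : Type _ :=
  Lp U ∞ (volume.restrict (Ici (0 : ℝ)))

/-- `x` is a mild solution on `[0,∞)` of `ẋ = A x + F(x,u)`, `x(0) = x₀`, where `T` is the semigroup
generated by `A`. -/
structure IsMildSolution (T : ℝ → X →L[ℂ] X) (F : X → U → X) (x₀ : X) (u : Input U)
    (x : ℝ → X) : Prop where
  continuousOn : ContinuousOn x (Ici 0)
  integrable : ∀ τ : ℝ, 0 < τ → IntegrableOn (fun s => F (x s) (u s)) (Icc 0 τ)
  eq : ∀ t : ℝ, 0 ≤ t → x t = T t x₀ + ∫ s in (0 : ℝ)..t, T (t - s) (F (x s) (u s))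

/-- Forward completeness: existence and uniqueness of the mild solution on `[0,∞)` for all
initial states and inputs. -/
def IsForwardComplete (T : ℝ → X →L[ℂ] X) (F : X → U → X) : Prop :=
  ∀ (x₀ : X) (u : Input U), ∃ x : ℝ → X, IsMildSolution T F x₀ u x ∧
    ∀ y : ℝ → X, IsMildSolution T F x₀ u y → EqOn y x (Ici 0)

/-- Uniform global stability. -/
structure IsUGS (T : ℝ → X →L[ℂ] X) (F : X → U → X) : Prop where
  forwardComplete : IsForwardComplete T F
  bound : ∃ γ μ : ℝ≥0 → ℝ≥0, IsClassKInf γ ∧ IsClassKInf μ ∧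
    ∀ (x₀ : X) (u : Input U) (x : ℝ → X), IsMildSolution T F x₀ u x →
      ∀ t : ℝ≥0, ‖x t‖₊ ≤ γ ‖x₀‖₊ + μ ‖u‖₊

/-- Polynomial input-to-state stability with parameter `α > 0` of `ẋ = A x + F(x,u)`, where `T` is
the semigroup generated by `A`; here `‖x₀‖ + ‖A x₀‖` is the graph norm of `x₀ ∈ D(A)`. -/
structure IsPolyISS (A : X →ₗ.[ℂ] X) (T : ℝ → X →L[ℂ] X) (F : X → U → X) (α : ℝ) : Prop where
  pos : 0 < α
  ugs : IsUGS T F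
  bound : ∃ (κ : ℝ≥0 → ℝ≥0 → ℝ≥0) (μ : ℝ≥0 → ℝ≥0), IsClassKL κ ∧ IsClassKInf μ ∧
    (∀ (x₀ : A.domain) (u : Input U) (x : ℝ → X), IsMildSolution T F (x₀ : X) u x →
      ∀ t : ℝ≥0, ‖x t‖₊ ≤ κ (‖(x₀ : X)‖₊ + ‖A x₀‖₊) t + μ ‖u‖₊) ∧
    ∀ r : ℝ≥0, 0 < r →
      (fun t : ℝ≥0 => (κ r t : ℝ)) =O[atTop] fun t : ℝ≥0 => (t : ℝ) ^ (-(1 / α))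

/-- Polynomial input-to-state stability with parameter `α` of the linear system
`ẋ = A x + B u`, where `T` is the semigroup generated by `A`. -/
def IsLinPolyISS (A : X →ₗ.[ℂ] X) (T : ℝ → X →L[ℂ] X) (B : U →L[ℂ] X) (α : ℝ) : Prop :=
  IsPolyISS A T (fun (_ : X) (v : U) => B v) α

end Systems

end

end PolyISS

/-! In a Riesz basis of eigenvectors everything is diagonal: `T t` multiplies the `n`-th coordinate
by `exp (t * lam n)`, and the operator `negPowNeg A α` multiplies it by a symbol `d n`. The
initial-state term is controlled by boundedness and polynomial decay of `T`, so the point is to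
bound the convolution of `T` with `B u` by a multiple of `‖u‖`, uniformly in `t`.

Applying the decay of `T t * A⁻¹` to an eigenvector at time `1 / |Re lam n|` shows that `‖lam n‖ ^
(-α)` is at most a constant times `|Re lam n|` (`IsPolynomiallyStable.eigenvalue_bound`). The
Balakrishnan integral gives `‖d n‖ ≤ C * ‖lam n‖ ^ (-α)` (`exists_symbol_negPowNeg`). Since `B u`
lies in the range of `negPowNeg A α` and `B` has finite rank, the coordinates of `B u` are at most
`‖u‖ * |Re lam n|` times those of one fixed vector, up to a constant. In each coordinate the
integral of `exp ((t - s) * Re lam n)` is at most `1 / |Re lam n|`, which cancels that factor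
(`norm_convolution_le`). Finite rank is what provides a single square summable majorant valid for
all input values. -/

namespace PolyISS

/-! ### Diagonal operators in a Riesz basis -/

section RieszBasis

variable {X : Type*} [NormedAddCommGroup X] [InnerProductSpace ℂ X]
  {φ : ℕ → X} {Q : X ≃L[ℂ] lp (fun _ : ℕ => ℂ) 2}

/-- An operator that is diagonal in a Riesz basis acts on coordinates by multiplication. -/
theorem coord_apply_of_diagonal (hQ : ∀ n, Q (φ n) = lp.single 2 n (1 : ℂ)) {S : X →L[ℂ] X}
    {d : ℕ → ℂ} (hS : ∀ n, S (φ n) = d n • φ n) (x : X) (n : ℕ) :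
    (Q (S x) : ℕ → ℂ) n = d n * (Q x : ℕ → ℂ) n := by
  have key : ((lp.evalCLM ℂ (fun _ : ℕ => ℂ) 2 n).comp
      ((Q : X →L[ℂ] lp (fun _ : ℕ => ℂ) 2).comp (S.comp (Q.symm : lp (fun _ : ℕ => ℂ) 2 →L[ℂ] X))))
      = d n • lp.evalCLM ℂ (fun _ : ℕ => ℂ) 2 n := by
    -- Both sides are continuous functionals on `ℓ²`, so testing them on the unit vectors is enough.
    refine lp.ext_continuousLinearMap (by simp) fun m => ?_
    ext
    have hm : Q.symm (lp.single 2 m (1 : ℂ)) = φ m := by rw [← hQ m, Q.symm_apply_apply]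
    have : lp.singleContinuousLinearMap ℂ (fun _ : ℕ => ℂ) 2 m (1 : ℂ) = lp.single 2 m (1 : ℂ) :=
      rfl
    simp only [ContinuousLinearMap.comp_apply, this, ContinuousLinearEquiv.coe_coe, hm, hS,
      map_smul, hQ, _root_.smul_apply]
    by_cases h : m = n
    · subst h; rfl
    · have : lp.evalCLM ℂ (fun _ : ℕ => ℂ) 2 n (lp.single 2 m (1 : ℂ)) = 0 :=
        lp.single_apply_ne (E := fun _ : ℕ => ℂ) 2 m (1 : ℂ) (Ne.symm h)
      simp [this]
  have := DFunLike.congr_fun key (Q x)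
  simpa using! this

/-- The `ℓ²` norm is monotone in the moduli of the coordinates; passing to `X` and back costs the
norms of `Q` and its inverse. -/
theorem norm_le_of_coord_le {x y : X} {c : ℝ} (hc : 0 ≤ c)
    (h : ∀ n, ‖(Q y : ℕ → ℂ) n‖ ≤ c * ‖(Q x : ℕ → ℂ) n‖) :
    ‖y‖ ≤ ‖(Q.symm : lp (fun _ : ℕ => ℂ) 2 →L[ℂ] X)‖ *
      ‖(Q : X →L[ℂ] lp (fun _ : ℕ => ℂ) 2)‖ * c * ‖x‖ := by
  have h1 : ‖Q y‖ ≤ c * ‖Q x‖ := by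
    have : ‖Q y‖ ≤ ‖(c : ℂ) • Q x‖ := by
      refine lp.norm_mono (by simp) fun n => ?_
      rw [lp.coeFn_smul, Pi.smul_apply, norm_smul, Complex.norm_of_nonneg hc]
      exact h n
    rwa [norm_smul, Complex.norm_of_nonneg hc] at this
  have h2 : ‖y‖ ≤ ‖(Q.symm : lp (fun _ : ℕ => ℂ) 2 →L[ℂ] X)‖ * ‖Q y‖ := by
    simpa using (Q.symm : lp (fun _ : ℕ => ℂ) 2 →L[ℂ] X).le_opNorm (Q y)
  have h3 : ‖Q x‖ ≤ ‖(Q : X →L[ℂ] lp (fun _ : ℕ => ℂ) 2)‖ * ‖x‖ :=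
    (Q : X →L[ℂ] lp (fun _ : ℕ => ℂ) 2).le_opNorm x
  calc ‖y‖ ≤ ‖(Q.symm : lp (fun _ : ℕ => ℂ) 2 →L[ℂ] X)‖ *
      (c * (‖(Q : X →L[ℂ] lp (fun _ : ℕ => ℂ) 2)‖ * ‖x‖)) :=
        h2.trans (by gcongr; exact h1.trans (by gcongr))
    _ = _ := by ring

/-- An operator that is diagonal in a Riesz basis is bounded by a multiple of its symbol. -/
theorem opNorm_le_of_diagonal (hQ : ∀ n, Q (φ n) = lp.single 2 n (1 : ℂ)) {S : X →L[ℂ] X}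
    {d : ℕ → ℂ} (hS : ∀ n, S (φ n) = d n • φ n) {c : ℝ} (hc : 0 ≤ c) (hd : ∀ n, ‖d n‖ ≤ c) :
    ‖S‖ ≤ ‖(Q.symm : lp (fun _ : ℕ => ℂ) 2 →L[ℂ] X)‖ *
      ‖(Q : X →L[ℂ] lp (fun _ : ℕ => ℂ) 2)‖ * c := by
  refine S.opNorm_le_bound (by positivity) fun x => norm_le_of_coord_le hc fun n => ?_
  rw [coord_apply_of_diagonal hQ hS, norm_mul]
  gcongr
  exact hd n

theorem ext_of_coord {x y : X} (h : ∀ n, (Q x : ℕ → ℂ) n = (Q y : ℕ → ℂ) n) : x = y :=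
  Q.injective (lp.ext (funext h))

/-- Every bounded sequence is the symbol of a bounded diagonal operator. -/
theorem exists_diagonal (hQ : ∀ n, Q (φ n) = lp.single 2 n (1 : ℂ)) {d : ℕ → ℂ} {c : ℝ}
    (hd : ∀ n, ‖d n‖ ≤ c) : ∃ S : X →L[ℂ] X, ∀ n, S (φ n) = d n • φ n := by
  have hc : 0 ≤ c := (norm_nonneg _).trans (hd 0)
  have hle : ∀ (f : lp (fun _ : ℕ => ℂ) 2) (n : ℕ), ‖d n * (f : ℕ → ℂ) n‖ ≤
      ‖((c : ℂ) • f : lp (fun _ : ℕ => ℂ) 2) n‖ := fun f n => by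
    simp only [lp.coeFn_smul, Pi.smul_apply, norm_smul, norm_mul, Complex.norm_real,
      Real.norm_of_nonneg hc]
    gcongr
    exact hd n
  have hmem : ∀ f : lp (fun _ : ℕ => ℂ) 2, Memℓp (fun n => d n * (f : ℕ → ℂ) n) 2 := fun f =>
    (lp.memℓp ((c : ℂ) • f)).mono' fun n => hle f n
  let D : lp (fun _ : ℕ => ℂ) 2 →ₗ[ℂ] lp (fun _ : ℕ => ℂ) 2 :=
    { toFun := fun f => ⟨fun n => d n * (f : ℕ → ℂ) n, hmem f⟩
      map_add' := fun f g => lp.ext (funext fun n => mul_add _ _ _)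
      map_smul' := fun a f => lp.ext (funext fun n => mul_left_comm _ _ _) }
  have hD : ∀ f, ‖D f‖ ≤ c * ‖f‖ := fun f => by
    have : ‖D f‖ ≤ ‖(c : ℂ) • f‖ := lp.norm_mono (by simp) fun n => hle f n
    rwa [norm_smul, Complex.norm_of_nonneg hc] at this
  refine ⟨(Q.symm : lp (fun _ : ℕ => ℂ) 2 →L[ℂ] X).comp ((D.mkContinuous c hD).comp
    (Q : X →L[ℂ] lp (fun _ : ℕ => ℂ) 2)), fun n => Q.injective ?_⟩
  simp only [ContinuousLinearMap.comp_apply, ContinuousLinearEquiv.coe_coe, hQ,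
    ContinuousLinearEquiv.apply_symm_apply, LinearMap.mkContinuous_apply, map_smul]
  refine lp.ext (funext fun m => ?_)
  change d m * (lp.single 2 n (1 : ℂ) : lp (fun _ : ℕ => ℂ) 2) m = d n * _
  by_cases h : m = n
  · rw [h]
  · have h0 := lp.single_apply_ne (E := fun _ : ℕ => ℂ) 2 n (1 : ℂ) h
    exact ((congrArg (d m * ·) h0).trans (mul_zero _)).trans
      ((congrArg (d n * ·) h0).trans (mul_zero _)).symm

end RieszBasis

end PolyISS

namespace PolyISS

/-! ### Semigroups: eigenvectors, strong continuity, spectral bounds, decay -/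

section Semigroup

variable {X : Type*} [NormedAddCommGroup X] [NormedSpace ℂ X] {A : X →ₗ.[ℂ] X} {T : ℝ → X →L[ℂ] X}

theorem resolventOp_spec {μ : ℂ} (h : μ ∈ resolventSet A) : IsResolventAt A μ (resolventOp A μ) := by
  rw [resolventOp, dif_pos h]
  exact Classical.choose_spec h

theorem IsResolventAt.smul_apply_eigenvector {μ lam : ℂ} {R : X →L[ℂ] X}
    (hR : IsResolventAt A μ R) {v : X} (hv : (v, lam • v) ∈ A.graph) : (μ - lam) • R v = v := by
  obtain ⟨y, hy, hy'⟩ := (LinearPMap.mem_graph_iff A).1 hv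
  have := hR.2 y
  simp only at hy hy'
  rw [hy', hy, ← sub_smul, map_smul] at this
  exact this

theorem IsResolventAt.apply_eigenvector {μ lam : ℂ} {R : X →L[ℂ] X}
    (hR : IsResolventAt A μ R) {v : X} (hv0 : v ≠ 0) (hv : (v, lam • v) ∈ A.graph) :
    μ ≠ lam ∧ R v = (μ - lam)⁻¹ • v := by
  have h := hR.smul_apply_eigenvector hv
  have hne : μ - lam ≠ 0 := fun h0 => hv0 (by rw [← h, h0, zero_smul])
  refine ⟨sub_ne_zero.1 hne, ?_⟩
  rw [← h, smul_smul, inv_mul_cancel₀ hne, one_smul, h]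

theorem IsC0Semigroup.tendsto_zero_right (hT : IsC0Semigroup T) (x : X) :
    Tendsto (fun t => T t x) (𝓝[≥] 0) (𝓝 x) := by
  have h : ContinuousWithinAt (fun t => T t x) (Ioi 0) 0 := by
    have := hT.tendsto_zero x
    rw [ContinuousWithinAt, hT.map_zero]
    exact this
  have := continuousWithinAt_Ioi_iff_Ici.1 h
  rw [ContinuousWithinAt, hT.map_zero] at this
  exact this

/-- Factoring out the smaller time bounds `‖T t x - T s x‖` by `M * ‖T |t - s| x - x‖`, so right
continuity at `0` gives continuity everywhere. Clamping with `max 0 t` avoids the unspecified values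
at negative times. -/
theorem IsC0Semigroup.continuous_extend (hT : IsC0Semigroup T) {M : ℝ}
    (hM : ∀ t, 0 ≤ t → ‖T t‖ ≤ M) (x : X) : Continuous fun t : ℝ => T (max 0 t) x := by
  have hle : ∀ s h : ℝ, 0 ≤ s → 0 ≤ h → ‖T (s + h) x - T s x‖ ≤ M * ‖T h x - x‖ := by
    intro s h hs hh
    rw [hT.map_add s h hs hh]
    have : (T s * T h) x - T s x = T s (T h x - x) := by
      rw [map_sub]; rfl
    rw [this]
    exact ((T s).le_opNorm _).trans (by gcongr; exact hM s hs)
  have hle' : ∀ s t : ℝ, 0 ≤ s → 0 ≤ t → ‖T t x - T s x‖ ≤ M * ‖T |t - s| x - x‖ := by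
    intro s t hs ht
    rcases le_total s t with h | h
    · have := hle s (t - s) hs (sub_nonneg.2 h)
      rwa [add_sub_cancel, ← abs_of_nonneg (sub_nonneg.2 h)] at this
    · have := hle t (s - t) ht (sub_nonneg.2 h)
      rwa [add_sub_cancel, ← abs_of_nonneg (sub_nonneg.2 h), norm_sub_rev, abs_sub_comm] at this
  rw [continuous_iff_continuousAt]
  intro s
  rw [ContinuousAt, tendsto_iff_norm_sub_tendsto_zero]
  have hlim : Tendsto (fun t : ℝ => |max 0 t - max 0 s|) (𝓝 s) (𝓝[≥] 0) := by
    refine tendsto_nhdsWithin_iff.2 ⟨?_, Eventually.of_forall fun t => mem_Ici.2 (abs_nonneg _)⟩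
    have : Continuous fun t : ℝ => |max 0 t - max 0 s| := by fun_prop
    simpa using this.tendsto s
  have h1 := ((hT.tendsto_zero_right x).comp hlim).sub_const x
  have h2 : Tendsto (fun t : ℝ => M * ‖T |max 0 t - max 0 s| x - x‖) (𝓝 s) (𝓝 0) := by
    simpa using h1.norm.const_mul M
  exact squeeze_zero (fun t => norm_nonneg _)
    (fun t => hle' _ _ (le_max_left _ _) (le_max_left _ _)) h2

theorem IsC0Semigroup.continuous_extend_uncurry (hT : IsC0Semigroup T) {M : ℝ}
    (hM : ∀ t, 0 ≤ t → ‖T t‖ ≤ M) : Continuous fun p : ℝ × X => T (max 0 p.1) p.2 := by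
  rw [continuous_iff_continuousAt]
  rintro ⟨s, x⟩
  rw [ContinuousAt, tendsto_iff_norm_sub_tendsto_zero]
  have h1 : Tendsto (fun p : ℝ × X => M * ‖p.2 - x‖ + ‖T (max 0 p.1) x - T (max 0 s) x‖)
      (𝓝 (s, x)) (𝓝 0) := by
    have : Continuous fun p : ℝ × X => M * ‖p.2 - x‖ + ‖T (max 0 p.1) x - T (max 0 s) x‖ := by
      have h : Continuous fun p : ℝ × X => T (max 0 p.1) x :=
        (hT.continuous_extend hM x).comp continuous_fst
      exact ((continuous_snd.sub continuous_const).norm.const_mul M).add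
        (h.sub continuous_const).norm
    simpa using this.tendsto (s, x)
  refine squeeze_zero (fun t => norm_nonneg _) (fun p => ?_) h1
  have : T (max 0 p.1) p.2 - T (max 0 s) x =
      T (max 0 p.1) (p.2 - x) + (T (max 0 p.1) x - T (max 0 s) x) := by
    rw [map_sub]; abel
  rw [this]
  refine (norm_add_le _ _).trans ?_
  gcongr
  exact ((T _).le_opNorm _).trans (by gcongr; exact hM _ (le_max_left _ _))

/-- The function `s ↦ exp (-s * lam) • T s v` is continuous with vanishing right derivative, hence
constant. Right derivatives suffice, and these come directly from the generator and the semigroup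
law. -/
theorem IsGeneratorOf.apply_eigenvector (hA : IsGeneratorOf A T) {M : ℝ}
    (hM : ∀ t, 0 ≤ t → ‖T t‖ ≤ M) {v : X} {lam : ℂ} (hv : (v, lam • v) ∈ A.graph) {t : ℝ}
    (ht : 0 ≤ t) : T t v = Complex.exp (t * lam) • v := by
  have hT := hA.isC0Semigroup
  have hderiv : ∀ s, 0 ≤ s → HasDerivWithinAt (fun s => T s v) (lam • T s v) (Ici s) s := by
    intro s hs
    rw [hasDerivWithinAt_iff_tendsto_slope, Ici_sdiff_left]
    have hlim : Tendsto (fun y : ℝ => y - s) (𝓝[>] s) (𝓝[>] 0) := by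
      refine tendsto_nhdsWithin_iff.2 ⟨?_, ?_⟩
      · have : Continuous fun y : ℝ => y - s := by fun_prop
        simpa using (this.tendsto s).mono_left nhdsWithin_le_nhds
      · filter_upwards [self_mem_nhdsWithin] with y hy using mem_Ioi.2 (sub_pos.2 (mem_Ioi.1 hy))
    have h1 := ((T s).continuous.tendsto _).comp (((hA.mem_graph_iff v _).1 hv).comp hlim)
    rw [map_smul] at h1
    refine h1.congr' ?_
    filter_upwards [self_mem_nhdsWithin] with y hy
    have h2 := hT.map_add s (y - s) hs (sub_pos.2 hy).le
    rw [add_sub_cancel] at h2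
    simp only [Function.comp_apply, slope, vsub_eq_sub, h2, map_smul, map_sub,
      mul_apply_eq_comp]
    rw [← Complex.ofReal_inv]
    rfl
  have hexp : ∀ s : ℝ, HasDerivAt (fun s : ℝ => Complex.exp (-(s * lam)))
      (-lam * Complex.exp (-(s * lam))) s := by
    intro s
    have h1 : HasDerivAt (fun s : ℝ => -((s : ℂ) * lam)) (-lam) s := by
      simpa using ((Complex.ofRealCLM.hasDerivAt (x := s)).mul_const lam).fun_neg
    simpa [mul_comm] using h1.cexp
  have hcont : ContinuousOn (fun s : ℝ => Complex.exp (-(s * lam)) • T s v) (Icc 0 t) := by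
    refine ContinuousOn.smul (by fun_prop) ?_
    refine (hT.continuous_extend hM v).continuousOn.congr fun s hs => ?_
    simp [max_eq_right hs.1]
  have hconst := constant_of_has_deriv_right_zero hcont (fun s hs => by
    have := (hexp s).hasDerivWithinAt.smul (hderiv s hs.1)
    refine this.congr_deriv ?_
    rw [smul_smul, ← add_smul]
    ring_nf
    simp) t ⟨ht, le_rfl⟩
  simp only [Complex.ofReal_zero, zero_mul, neg_zero, Complex.exp_zero, hT.map_zero, one_smul,
    one_apply_eq_self] at hconst
  calc T t v = (Complex.exp (t * lam) * Complex.exp (-(t * lam))) • T t v := by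
        rw [← Complex.exp_add]; simp
    _ = _ := by rw [mul_smul, hconst]

/-- For a polynomially stable semigroup, the eigenvalues of the generator are bounded away from
`0`, lie in the open left half plane and approach the imaginary axis at most polynomially. -/
theorem IsPolynomiallyStable.eigenvalue_bound (hA : IsGeneratorOf A T) {α : ℝ}
    (hstab : IsPolynomiallyStable A T α) : ∃ δ C : ℝ, 0 < δ ∧ 0 < C ∧ ∀ (v : X) (lam : ℂ), v ≠ 0 →
      (v, lam • v) ∈ A.graph → δ ≤ ‖lam‖ ∧ lam.re < 0 ∧ ‖lam‖ ^ (-α) ≤ C * -lam.re := by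
  obtain ⟨M, hM⟩ := hstab.semiUniformlyStable.bounded
  have hα := hstab.pos
  have hR := resolventOp_spec hstab.zero_mem
  set R := resolventOp A 0
  obtain ⟨K, hK, hbound⟩ := hstab.isBigO.exists_pos
  obtain ⟨t₀, ht₀⟩ := eventually_atTop.1 hbound.bound
  set t₁ := max t₀ 1
  have ht₁ : 0 < t₁ := lt_max_of_lt_right one_pos
  -- `lam⁻¹` is, up to sign, an eigenvalue of `R`, so `‖lam‖⁻¹ ≤ ‖R‖`; the `+ 1` keeps the inverse
  -- positive.
  set δ : ℝ := (‖R‖ + 1)⁻¹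
  have hδ : 0 < δ := by positivity
  refine ⟨δ, (Real.exp 1 * K) ^ α + δ ^ (-α) * t₁, hδ, by positivity, fun v lam hv0 hv => ?_⟩
  obtain ⟨hne, hRv⟩ := hR.apply_eigenvector hv0 hv
  have hvpos : 0 < ‖v‖ := norm_pos_iff.2 hv0
  have hlam : 0 < ‖lam‖ := norm_pos_iff.2 hne.symm
  have hlamδ : δ ≤ ‖lam‖ := by
    have h1 := R.le_opNorm v
    rw [hRv, norm_smul, zero_sub, norm_inv, norm_neg] at h1
    have h2 := le_of_mul_le_mul_right h1 hvpos
    refine inv_le_of_inv_le₀ hlam (h2.trans (by linarith))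
  have key : ∀ t, t₁ ≤ t → Real.exp (t * lam.re) * ‖lam‖⁻¹ ≤ K * t ^ (-(1 / α)) := by
    intro t ht
    have ht' : 0 < t := ht₁.trans_le ht
    have h1 := ht₀ t ((le_max_left _ _).trans ht)
    rw [Real.norm_of_nonneg (by positivity : 0 ≤ t ^ (-(1 / α))), norm_norm] at h1
    have h2 : (T t * -R) v = (Complex.exp (t * lam) * lam⁻¹) • v := by
      simp only [mul_apply_eq_comp, _root_.neg_apply, hRv]
      rw [map_neg, map_smul, hA.apply_eigenvector hM hv ht'.le, smul_smul, ← neg_smul]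
      congr 1
      rw [zero_sub, inv_neg]; ring
    have h3 := ((T t * -R).le_opNorm v).trans (mul_le_mul_of_nonneg_right h1 hvpos.le)
    rw [h2, norm_smul] at h3
    have h4 := le_of_mul_le_mul_right h3 hvpos
    rw [norm_mul, Complex.norm_exp, norm_inv] at h4
    simpa using h4
  -- If `Re lam ≥ 0`, the left side of `key` stays above `‖lam‖⁻¹` while the right side tends to
  -- `0`.
  have hre : lam.re < 0 := by
    by_contra! hge
    have hlim : Tendsto (fun t : ℝ => K * t ^ (-(1 / α))) atTop (𝓝 0) := by
      simpa using (tendsto_rpow_neg_atTop (by positivity : 0 < 1 / α)).const_mul K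
    have : ‖lam‖⁻¹ ≤ 0 := by
      refine ge_of_tendsto hlim ?_
      filter_upwards [eventually_ge_atTop t₁] with t ht
      refine le_trans ?_ (key t ht)
      refine le_mul_of_one_le_left (by positivity) (Real.one_le_exp ?_)
      exact mul_nonneg (ht₁.le.trans ht) hge
    exact absurd this (not_le.2 (by positivity))
  refine ⟨hlamδ, hre, ?_⟩
  set ω := -lam.re
  have hω : 0 < ω := neg_pos.2 hre
  rw [add_mul]
  -- If `ω⁻¹` is past the threshold, `key` at `t = ω⁻¹` raised to the power `α` gives the constant
  -- `(e K) ^ α`. Otherwise `ω` is bounded below by `1 / t₁`, and `‖lam‖ ≥ δ` gives the second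
  -- constant.
  rcases le_total t₁ ω⁻¹ with h | h
  · have h1 := key _ h
    have h2 : ω⁻¹ * lam.re = -1 := by
      rw [show lam.re = -ω from (neg_neg _).symm]
      field_simp
    rw [h2, Real.exp_neg, Real.inv_rpow hω.le, Real.rpow_neg hω.le, inv_inv,
      inv_mul_le_iff₀ (Real.exp_pos 1), ← mul_assoc] at h1
    have h3 := Real.rpow_le_rpow (by positivity) h1 hα.le
    rw [Real.mul_rpow (by positivity) (by positivity), ← Real.rpow_mul hω.le,
      one_div_mul_cancel hα.ne', Real.rpow_one, Real.inv_rpow hlam.le, ← Real.rpow_neg hlam.le] at h3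
    have : 0 ≤ δ ^ (-α) * t₁ * ω := by positivity
    linarith
  · have h1 : 1 ≤ t₁ * ω := by
      rwa [← inv_le_iff_one_le_mul₀ hω]
    have h2 : ‖lam‖ ^ (-α) ≤ δ ^ (-α) := Real.rpow_le_rpow_of_nonpos hδ hlamδ (by linarith)
    have h3 : δ ^ (-α) * 1 ≤ δ ^ (-α) * (t₁ * ω) := by gcongr
    have : 0 ≤ (Real.exp 1 * K) ^ α * ω := by positivity
    linarith

/-- Decay of classical solutions of a polynomially stable semigroup in the graph norm. -/
theorem IsPolynomiallyStable.decay {α : ℝ} (hstab : IsPolynomiallyStable A T α) :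
    ∃ K : ℝ, 0 < K ∧ ∀ (x : A.domain) (t : ℝ), 0 ≤ t →
      ‖T t x‖ ≤ K * (‖(x : X)‖ + ‖A x‖) * (1 + t) ^ (-(1 / α)) := by
  obtain ⟨M, hM⟩ := hstab.semiUniformlyStable.bounded
  have hM0 : 0 ≤ M := (norm_nonneg _).trans (hM 0 le_rfl)
  have hα := hstab.pos
  have hR := resolventOp_spec hstab.zero_mem
  set R := resolventOp A 0
  obtain ⟨K, hK, hbound⟩ := hstab.isBigO.exists_pos
  obtain ⟨t₀, ht₀⟩ := eventually_atTop.1 hbound.bound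
  set t₁ := max t₀ 1
  have ht₁ : 1 ≤ t₁ := le_max_right _ _
  have hpos : ∀ t : ℝ, 0 ≤ t → 0 < (1 + t) ^ (-(1 / α)) := fun t ht => by positivity
  -- The first summand covers `t ≤ t₁` by boundedness of `T`. The second covers `t ≥ t₁`, where `T t
  -- x = T t (A⁻¹ (A x))` and `t ≥ (1 + t) / 2` because `t₁ ≥ 1`.
  refine ⟨M * (1 + t₁) ^ (1 / α) + K * 2 ^ (1 / α), by positivity, fun x t ht => ?_⟩
  rw [add_mul, add_mul]
  have hsum : ∀ c : ℝ, 0 ≤ c → 0 ≤ c * (‖(x : X)‖ + ‖A x‖) * (1 + t) ^ (-(1 / α)) := fun c hc => by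
    have := hpos t ht
    positivity
  rcases le_total t t₁ with h | h
  · refine le_trans ?_ (le_add_of_nonneg_right (hsum _ (by positivity)))
    have h1 : 1 ≤ (1 + t₁) ^ (1 / α) * (1 + t) ^ (-(1 / α)) := by
      rw [Real.rpow_neg (by positivity), ← div_eq_mul_inv, one_le_div (by positivity)]
      gcongr
    calc ‖T t x‖ ≤ M * ‖(x : X)‖ := ((T t).le_opNorm _).trans (by gcongr; exact hM t ht)
      _ ≤ M * (‖(x : X)‖ + ‖A x‖) * 1 := by
        rw [mul_one]; gcongr; exact le_add_of_nonneg_right (norm_nonneg _)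
      _ ≤ M * (‖(x : X)‖ + ‖A x‖) * ((1 + t₁) ^ (1 / α) * (1 + t) ^ (-(1 / α))) := by gcongr
      _ = _ := by ring
  · refine le_trans ?_ (le_add_of_nonneg_left (hsum _ (by positivity)))
    have ht' : 0 < t := by linarith
    have h1 := ht₀ t ((le_max_left _ _).trans h)
    rw [Real.norm_of_nonneg (by positivity : 0 ≤ t ^ (-(1 / α))), norm_norm] at h1
    have h2 : (T t * -R) (A x) = T t x := by
      have := hR.2 x
      rw [zero_smul, zero_sub, map_neg] at this
      rw [mul_apply_eq_comp, _root_.neg_apply, this]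
    have h3 : t ^ (-(1 / α)) ≤ 2 ^ (1 / α) * (1 + t) ^ (-(1 / α)) := by
      have h4 : ((1 + t) / 2) ^ (1 / α) ≤ t ^ (1 / α) :=
        Real.rpow_le_rpow (by positivity) (by linarith) (by positivity)
      rw [Real.div_rpow (by positivity) (by positivity)] at h4
      rw [Real.rpow_neg ht'.le, Real.rpow_neg (by positivity)]
      calc (t ^ (1 / α))⁻¹ ≤ ((1 + t) ^ (1 / α) / 2 ^ (1 / α))⁻¹ := by gcongr
        _ = _ := by rw [inv_div, div_eq_mul_inv]
    calc ‖T t x‖ ≤ K * t ^ (-(1 / α)) * ‖A x‖ := by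
          rw [← h2]; exact ((T t * -R).le_opNorm _).trans (by gcongr)
      _ ≤ K * (2 ^ (1 / α) * (1 + t) ^ (-(1 / α))) * (‖(x : X)‖ + ‖A x‖) := by
          gcongr; exact le_add_of_nonneg_left (norm_nonneg _)
      _ = _ := by ring

end Semigroup

end PolyISS

namespace PolyISS

/-! ### Negative fractional powers as diagonal operators -/

section FractionalPower

/-- Together the two bounds give `max t ‖lam‖ ≤ ‖t - lam‖`, which reduces the Balakrishnan integrand
to an explicit real majorant. -/
theorem le_norm_ofReal_sub {t : ℝ} {lam : ℂ} (ht : 0 ≤ t) (hlam : lam.re ≤ 0) :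
    t ≤ ‖(t : ℂ) - lam‖ ∧ ‖lam‖ ≤ ‖(t : ℂ) - lam‖ := by
  constructor
  · have := Complex.re_le_norm ((t : ℂ) - lam)
    simp only [Complex.sub_re, Complex.ofReal_re] at this
    linarith
  · rw [Complex.norm_eq_sqrt_sq_add_sq, Complex.norm_eq_sqrt_sq_add_sq]
    refine Real.sqrt_le_sqrt ?_
    simp only [Complex.sub_re, Complex.ofReal_re, Complex.sub_im, Complex.ofReal_im]
    nlinarith [mul_nonneg ht (neg_nonneg.2 hlam)]

/-- The scalar majorant of the Balakrishnan integrand and its integral. -/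
theorem integral_rpow_mul_inv_max_pow {α : ℝ} (hα : 0 < α) (n : ℕ) (hn : α < n) {ρ : ℝ}
    (hρ : 0 < ρ) :
    IntegrableOn (fun t : ℝ => t ^ ((n : ℝ) - α - 1) * ((max t ρ)⁻¹) ^ n) (Ioi 0) ∧
      ∫ t in Ioi (0 : ℝ), t ^ ((n : ℝ) - α - 1) * ((max t ρ)⁻¹) ^ n =
        (1 / ((n : ℝ) - α) + 1 / α) * ρ ^ (-α) := by
  -- Splitting at `ρ` leaves pure powers on each piece: convergence at `0` needs `α < n`,
  -- convergence at infinity needs `0 < α`.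
  have e1 : EqOn (fun t : ℝ => t ^ ((n : ℝ) - α - 1) * (ρ⁻¹) ^ n)
      (fun t : ℝ => t ^ ((n : ℝ) - α - 1) * ((max t ρ)⁻¹) ^ n) (Ioc 0 ρ) := fun t ht => by
    simp only [max_eq_right ht.2]
  have e2 : EqOn (fun t : ℝ => t ^ (-α - 1))
      (fun t : ℝ => t ^ ((n : ℝ) - α - 1) * ((max t ρ)⁻¹) ^ n) (Ioi ρ) := fun t ht => by
    have ht0 : 0 < t := hρ.trans ht
    simp only [max_eq_left (mem_Ioi.1 ht).le]
    rw [inv_pow, ← Real.rpow_natCast, ← Real.rpow_neg ht0.le, ← Real.rpow_add ht0]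
    congr 1; ring
  have hi1 : IntegrableOn (fun t : ℝ => t ^ ((n : ℝ) - α - 1) * (ρ⁻¹) ^ n) (Ioc 0 ρ) := by
    have := (intervalIntegral.intervalIntegrable_rpow' (a := 0) (b := ρ)
      (by linarith : -1 < (n : ℝ) - α - 1)).mul_const ((ρ⁻¹) ^ n)
    exact (intervalIntegrable_iff_integrableOn_Ioc_of_le hρ.le).1 this
  have hi2 : IntegrableOn (fun t : ℝ => t ^ (-α - 1)) (Ioi ρ) :=
    integrableOn_Ioi_rpow_of_lt (by linarith) hρ
  have hj1 := hi1.congr_fun e1 measurableSet_Ioc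
  have hj2 := hi2.congr_fun e2 measurableSet_Ioi
  rw [← Ioc_union_Ioi_eq_Ioi hρ.le]
  refine ⟨hj1.union hj2, ?_⟩
  rw [setIntegral_union Ioc_disjoint_Ioi_same measurableSet_Ioi hj1 hj2,
    ← setIntegral_congr_fun measurableSet_Ioc e1, ← setIntegral_congr_fun measurableSet_Ioi e2,
    integral_mul_const, ← intervalIntegral.integral_of_le hρ.le,
    integral_rpow (Or.inl (by linarith)), integral_Ioi_rpow_of_lt (by linarith) hρ,
    show (n : ℝ) - α - 1 + 1 = n - α by ring, show -α - 1 + 1 = -α by ring,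
    Real.zero_rpow (by linarith), sub_zero, add_mul, neg_div_neg_eq, inv_pow, ← Real.rpow_natCast,
    ← Real.rpow_neg hρ.le, div_mul_eq_mul_div, ← Real.rpow_add hρ,
    show (n : ℝ) - α + -n = -α by ring]
  ring

variable {X : Type*} [NormedAddCommGroup X] [InnerProductSpace ℂ X] {A : X →ₗ.[ℂ] X}
  {φ : ℕ → X} {Q : X ≃L[ℂ] lp (fun _ : ℕ => ℂ) 2} {lam : ℕ → ℂ}

theorem ne_zero_of_rieszBasis (hQ : ∀ n, Q (φ n) = lp.single 2 n (1 : ℂ)) (n : ℕ) : φ n ≠ 0 := by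
  intro h
  have h1 := lp.single_apply_self (E := fun _ : ℕ => ℂ) 2 n (1 : ℂ)
  rw [← hQ n, h, map_zero] at h1
  exact zero_ne_one h1

/-- Positive reals belong to the resolvent set of an invertible diagonalizable operator with
spectrum in the closed left half plane. -/
theorem ofReal_mem_resolventSet (hQ : ∀ n, Q (φ n) = lp.single 2 n (1 : ℂ))
    (hlam : ∀ n, (φ n, lam n • φ n) ∈ A.graph) (hre : ∀ n, (lam n).re ≤ 0)
    (h0 : (0 : ℂ) ∈ resolventSet A) {t : ℝ} (ht : 0 < t) : (t : ℂ) ∈ resolventSet A := by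
  have hR₀ := resolventOp_spec h0
  set R₀ := resolventOp A 0
  have hne : ∀ n, lam n ≠ 0 := fun n =>
    (hR₀.apply_eigenvector (ne_zero_of_rieszBasis hQ n) (hlam n)).1.symm
  have hR₀φ : ∀ n, R₀ (φ n) = (0 - lam n)⁻¹ • φ n := fun n =>
    (hR₀.apply_eigenvector (ne_zero_of_rieszBasis hQ n) (hlam n)).2
  have hnorm : ∀ n, 0 < ‖(t : ℂ) - lam n‖ := fun n =>
    ht.trans_le (le_norm_ofReal_sub ht.le (hre n)).1
  have hne' : ∀ n, (t : ℂ) - lam n ≠ 0 := fun n => norm_pos_iff.1 (hnorm n)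
  obtain ⟨R, hR⟩ := exists_diagonal hQ (d := fun n => ((t : ℂ) - lam n)⁻¹) (c := t⁻¹) fun n => by
    rw [norm_inv]
    exact inv_anti₀ ht (le_norm_ofReal_sub ht.le (hre n)).1
  refine ⟨R, fun x => ?_, fun x => ?_⟩
  -- Writing `R x` as a value of `R₀` places it in the domain of `A`; the identity itself is checked
  -- on coordinates.
  · have h1 : R₀ (x - (t : ℂ) • R x) = R x := ext_of_coord (Q := Q) fun n => by
      rw [coord_apply_of_diagonal hQ hR₀φ, map_sub, map_smul, lp.coeFn_sub, Pi.sub_apply,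
        lp.coeFn_smul, Pi.smul_apply, coord_apply_of_diagonal hQ hR, smul_eq_mul]
      have := hne n
      have := hne' n
      rw [zero_sub]
      field_simp
      ring
    have h2 := hR₀.1 (x - (t : ℂ) • R x)
    rwa [h1, zero_smul, zero_sub, neg_sub] at h2
  · have h1 := hR₀.2 x
    rw [zero_smul, zero_sub] at h1
    set y := -A x
    have h2 : A x = -y := (neg_neg _).symm
    rw [h2, sub_neg_eq_add, ← h1]
    refine ext_of_coord (Q := Q) fun n => ?_
    rw [coord_apply_of_diagonal hQ hR, map_add, map_smul, lp.coeFn_add, Pi.add_apply,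
        lp.coeFn_smul, Pi.smul_apply, coord_apply_of_diagonal hQ hR₀φ, smul_eq_mul]
    have := hne n
    have := hne' n
    rw [zero_sub]
    field_simp
    ring

theorem resolventOp_pow_apply_eigenvector {A : X →ₗ.[ℂ] X} {μ l : ℂ} (hμ : μ ∈ resolventSet A)
    {v : X} (hv0 : v ≠ 0) (hv : (v, l • v) ∈ A.graph) (k : ℕ) :
    (resolventOp A μ ^ k) v = ((μ - l)⁻¹) ^ k • v := by
  induction k with
  | zero => simp
  | succ k ih =>
    rw [pow_succ, mul_apply_eq_comp, ((resolventOp_spec hμ).apply_eigenvector hv0 hv).2, map_smul,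
      ih, smul_smul, pow_succ']

/-- The Balakrishnan integrand for the negative fractional power is integrable. -/
theorem integrableOn_negPowNeg (hQ : ∀ n, Q (φ n) = lp.single 2 n (1 : ℂ))
    (hlam : ∀ n, (φ n, lam n • φ n) ∈ A.graph) (hre : ∀ n, (lam n).re ≤ 0) {δ : ℝ} (hδ : 0 < δ)
    (hδlam : ∀ n, δ ≤ ‖lam n‖) (h0 : (0 : ℂ) ∈ resolventSet A) {α : ℝ} (hα : 0 < α) :
    IntegrableOn (fun t : ℝ => ((t ^ ((⌊α⌋₊ + 1 : ℝ) - α - 1) : ℝ) : ℂ) •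
      resolventOp A (t : ℂ) ^ (⌊α⌋₊ + 1)) (Ioi 0) := by
  have hmem : ∀ t : ℝ, 0 < t → (t : ℂ) ∈ resolventSet A := fun t ht =>
    ofReal_mem_resolventSet hQ hlam hre h0 ht
  have hφ := ne_zero_of_rieszBasis hQ
  set K := ‖(Q.symm : lp (fun _ : ℕ => ℂ) 2 →L[ℂ] X)‖ *
      ‖(Q : X →L[ℂ] lp (fun _ : ℕ => ℂ) 2)‖
  have hK : 0 ≤ K := by positivity
  have hnorm : ∀ (t : ℝ) (n : ℕ), 0 < t → max t δ ≤ ‖(t : ℂ) - lam n‖ := fun t n ht =>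
    max_le (le_norm_ofReal_sub ht.le (hre n)).1
      ((hδlam n).trans (le_norm_ofReal_sub ht.le (hre n)).2)
  have hpos : ∀ t : ℝ, 0 < max t δ := fun t => lt_max_of_lt_right hδ
  have hinv : ∀ (t : ℝ) (n : ℕ), 0 < t → ‖((t : ℂ) - lam n)⁻¹‖ ≤ (max t δ)⁻¹ := fun t n ht => by
    rw [norm_inv]
    exact inv_anti₀ (hpos t) (hnorm t n ht)
  -- The resolvent identity for symbols makes the resolvent Lipschitz in operator norm, which yields
  -- measurability of the integrand.
  have hdiff : ∀ s t : ℝ, 0 < s → 0 < t →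
      ‖resolventOp A (t : ℂ) - resolventOp A (s : ℂ)‖ ≤ K * (|s - t| * (δ⁻¹ * δ⁻¹)) := by
    intro s t hs ht
    refine opNorm_le_of_diagonal hQ
      (d := fun n => ((t : ℂ) - lam n)⁻¹ - ((s : ℂ) - lam n)⁻¹) (fun n => ?_) (by positivity)
      fun n => ?_
    · rw [_root_.sub_apply, ((resolventOp_spec (hmem t ht)).apply_eigenvector (hφ n) (hlam n)).2,
        ((resolventOp_spec (hmem s hs)).apply_eigenvector (hφ n) (hlam n)).2, sub_smul]
    · have ht' : (t : ℂ) - lam n ≠ 0 := norm_pos_iff.1 ((hpos t).trans_le (hnorm t n ht))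
      have hs' : (s : ℂ) - lam n ≠ 0 := norm_pos_iff.1 ((hpos s).trans_le (hnorm s n hs))
      have : ((t : ℂ) - lam n)⁻¹ - ((s : ℂ) - lam n)⁻¹ =
          ((s - t : ℝ) : ℂ) * (((t : ℂ) - lam n)⁻¹ * ((s : ℂ) - lam n)⁻¹) := by
        rw [inv_sub_inv ht' hs', Complex.ofReal_sub]
        field_simp
        ring
      rw [this, norm_mul, norm_mul, Complex.norm_real, Real.norm_eq_abs]
      gcongr
      · exact (hinv t n ht).trans (inv_anti₀ hδ (le_max_right _ _))
      · exact (hinv s n hs).trans (inv_anti₀ hδ (le_max_right _ _))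
  have hcont : ContinuousOn (fun t : ℝ => resolventOp A (t : ℂ)) (Ioi 0) := by
    intro s hs
    rw [ContinuousWithinAt, tendsto_iff_norm_sub_tendsto_zero]
    have hlim : Tendsto (fun t : ℝ => K * (|s - t| * (δ⁻¹ * δ⁻¹))) (𝓝[Ioi 0] s) (𝓝 0) := by
      have : Continuous fun t : ℝ => K * (|s - t| * (δ⁻¹ * δ⁻¹)) := by fun_prop
      simpa using (this.tendsto s).mono_left nhdsWithin_le_nhds
    refine squeeze_zero' (Eventually.of_forall fun _ => norm_nonneg _) ?_ hlim
    filter_upwards [self_mem_nhdsWithin] with t ht using hdiff s t hs ht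
  have hn : α < ((⌊α⌋₊ + 1 : ℕ) : ℝ) := by exact_mod_cast Nat.lt_floor_add_one α
  have hmaj := (integral_rpow_mul_inv_max_pow hα _ hn hδ).1.const_mul K
  refine Integrable.mono' hmaj (ContinuousOn.aestronglyMeasurable ?_ measurableSet_Ioi) ?_
  · refine ContinuousOn.smul (Complex.continuous_ofReal.comp_continuousOn
      (ContinuousOn.rpow_const continuousOn_id fun t ht => Or.inl (ne_of_gt ht))) (hcont.pow _)
  · refine (ae_restrict_iff' measurableSet_Ioi).2 (Eventually.of_forall fun t ht => ?_)
    have ht0 : 0 < t := ht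
    rw [norm_smul, Complex.norm_real, Real.norm_of_nonneg (by positivity), Nat.cast_add,
      Nat.cast_one, mul_left_comm]
    refine mul_le_mul_of_nonneg_left ?_ (by positivity)
    refine opNorm_le_of_diagonal hQ (d := fun n => (((t : ℂ) - lam n)⁻¹) ^ (⌊α⌋₊ + 1))
      (fun n => resolventOp_pow_apply_eigenvector (hmem t ht0) (hφ n) (hlam n) _)
      (by have := hpos t; positivity) fun n => ?_
    rw [norm_pow]
    gcongr
    exact hinv t n ht0

/-- The fractional power `(-A)^{-α}` is diagonal, with symbol of size `|λₙ|^{-α}`. -/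
theorem exists_symbol_negPowNeg [CompleteSpace X] (hQ : ∀ n, Q (φ n) = lp.single 2 n (1 : ℂ))
    (hlam : ∀ n, (φ n, lam n • φ n) ∈ A.graph) (hre : ∀ n, (lam n).re ≤ 0) {δ : ℝ} (hδ : 0 < δ)
    (hδlam : ∀ n, δ ≤ ‖lam n‖) (h0 : (0 : ℂ) ∈ resolventSet A) {α : ℝ} (hα : 0 < α) :
    ∃ (d : ℕ → ℂ) (C : ℝ), 0 ≤ C ∧ (∀ n, negPowNeg A α (φ n) = d n • φ n) ∧
      ∀ n, ‖d n‖ ≤ C * ‖lam n‖ ^ (-α) := by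
  have hint := integrableOn_negPowNeg hQ hlam hre hδ hδlam h0 hα
  have hφ := ne_zero_of_rieszBasis hQ
  have hn : α < ((⌊α⌋₊ + 1 : ℕ) : ℝ) := by exact_mod_cast Nat.lt_floor_add_one α
  set G : ℂ := ((Real.Gamma (⌊α⌋₊ + 1) / (Real.Gamma α * Real.Gamma (⌊α⌋₊ + 1 - α)) : ℝ) : ℂ)
    with hG
  -- The symbol is left as a scalar Balakrishnan integral: only its modulus is needed, so it is not
  -- evaluated as a complex power.
  refine ⟨fun n => G * ∫ t in Ioi (0 : ℝ), ((t ^ ((⌊α⌋₊ + 1 : ℝ) - α - 1) : ℝ) : ℂ) *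
    (((t : ℂ) - lam n)⁻¹) ^ (⌊α⌋₊ + 1), ‖G‖ * (1 / (((⌊α⌋₊ + 1 : ℕ) : ℝ) - α) + 1 / α), ?_,
    fun n => ?_, fun n => ?_⟩
  · have := sub_pos.2 hn
    positivity
  · rw [negPowNeg, ← hG, _root_.smul_apply, ContinuousLinearMap.integral_apply hint, mul_smul,
      ← integral_smul_const]
    congr 1
    refine setIntegral_congr_fun measurableSet_Ioi fun t ht => ?_
    simp only [_root_.smul_apply]
    rw [resolventOp_pow_apply_eigenvector (ofReal_mem_resolventSet hQ hlam hre h0 ht) (hφ n)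
      (hlam n), smul_smul]
  · have hl : 0 < ‖lam n‖ := hδ.trans_le (hδlam n)
    obtain ⟨hi, he⟩ := integral_rpow_mul_inv_max_pow hα _ hn hl
    rw [norm_mul, mul_assoc]
    gcongr
    rw [← he]
    refine norm_integral_le_of_norm_le hi ?_
    refine (ae_restrict_iff' measurableSet_Ioi).2 (Eventually.of_forall fun t ht => ?_)
    have ht0 : 0 < t := ht
    rw [norm_mul, Complex.norm_real, Real.norm_of_nonneg (by positivity), Nat.cast_add,
      Nat.cast_one, norm_pow, norm_inv]
    gcongr
    exact max_le (le_norm_ofReal_sub ht0.le (hre n)).1 (le_norm_ofReal_sub ht0.le (hre n)).2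

end FractionalPower

end PolyISS

/-! ### Bounded inputs and continuity of the convolution -/

namespace PolyISS

theorem Input.ae_norm_le {U : Type*} [NormedAddCommGroup U] (u : Input U) :
    ∀ᵐ s ∂volume.restrict (Ici (0 : ℝ)), ‖u s‖ ≤ ‖u‖ := by
  have h := ae_le_lpNorm_exponent_top (Lp.memLp u)
  rwa [← toReal_eLpNorm (Lp.aestronglyMeasurable u), ← Lp.norm_def] at h

section Convolution

variable {X : Type*} [NormedAddCommGroup X] [NormedSpace ℂ X] {T : ℝ → X →L[ℂ] X} {M G : ℝ}
  {g : ℝ → X}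

theorem IsC0Semigroup.aestronglyMeasurable_extend (hT : IsC0Semigroup T)
    (hM : ∀ t, 0 ≤ t → ‖T t‖ ≤ M) {ν : Measure ℝ} (hg : AEStronglyMeasurable g ν) (t : ℝ) :
    AEStronglyMeasurable (fun s => T (max 0 (t - s)) (g s)) ν :=
  (hT.continuous_extend_uncurry hM).comp_aestronglyMeasurable
    ((by fun_prop : Continuous fun s : ℝ => t - s).aestronglyMeasurable.prodMk hg)

theorem ae_norm_apply_le (hM : ∀ t, 0 ≤ t → ‖T t‖ ≤ M)
    (hG : ∀ᵐ s ∂volume.restrict (Ici (0 : ℝ)), ‖g s‖ ≤ G) (t b : ℝ) :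
    ∀ᵐ s ∂volume.restrict (Ioc (0 : ℝ) b), ‖T (max 0 (t - s)) (g s)‖ ≤ M * G := by
  have hM0 : 0 ≤ M := (norm_nonneg _).trans (hM 0 le_rfl)
  filter_upwards [ae_restrict_of_ae_restrict_of_subset
    (Ioc_subset_Icc_self.trans Icc_subset_Ici_self) hG] with s hs
  exact ((T _).le_opNorm _).trans (mul_le_mul (hM _ (le_max_left _ _)) hs (norm_nonneg _) hM0)

theorem IsC0Semigroup.intervalIntegrable_convolution (hT : IsC0Semigroup T)
    (hM : ∀ t, 0 ≤ t → ‖T t‖ ≤ M)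
    (hg : AEStronglyMeasurable g (volume.restrict (Ici 0)))
    (hG : ∀ᵐ s ∂volume.restrict (Ici (0 : ℝ)), ‖g s‖ ≤ G) {t : ℝ} (ht : 0 ≤ t) :
    IntervalIntegrable (fun s => T (t - s) (g s)) volume 0 t := by
  rw [intervalIntegrable_iff_integrableOn_Ioc_of_le ht]
  have h1 : IntegrableOn (fun s => T (max 0 (t - s)) (g s)) (Ioc 0 t) :=
    Integrable.mono' (g := fun _ => M * G) (integrable_const _)
      (hT.aestronglyMeasurable_extend hM (hg.mono_set
        (Ioc_subset_Icc_self.trans Icc_subset_Ici_self)) t) (ae_norm_apply_le hM hG t t)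
  exact h1.congr_fun (fun s hs => by simp only [max_eq_right (sub_nonneg.2 hs.2)])
    measurableSet_Ioc

theorem IsC0Semigroup.continuousOn_convolution (hT : IsC0Semigroup T)
    (hM : ∀ t, 0 ≤ t → ‖T t‖ ≤ M)
    (hg : AEStronglyMeasurable g (volume.restrict (Ici 0)))
    (hG : ∀ᵐ s ∂volume.restrict (Ici (0 : ℝ)), ‖g s‖ ≤ G) :
    ContinuousOn (fun t : ℝ => ∫ s in (0 : ℝ)..t, T (t - s) (g s)) (Ici 0) := by
  intro t₀ ht₀
  set b := t₀ + 1
  -- The indicator moves the variable endpoint into the integrand, so dominated convergence applies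
  -- on a fixed interval. The integrand is continuous in `t` at `t₀` except for the null set `s =
  -- t₀`.
  let F : ℝ → ℝ → X := fun t => (Iic t).indicator fun s => T (max 0 (t - s)) (g s)
  have hF : ∀ t ∈ Icc 0 b, ∫ s in (0 : ℝ)..t, T (t - s) (g s) = ∫ s in Ioc 0 b, F t s := by
    intro t ht
    rw [setIntegral_indicator measurableSet_Iic, Ioc_inter_Iic, min_eq_right ht.2,
      intervalIntegral.integral_of_le ht.1]
    exact setIntegral_congr_fun measurableSet_Ioc fun s hs => by
      simp only [max_eq_right (sub_nonneg.2 hs.2)]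
  have hev : ∀ᶠ t in 𝓝[Ici 0] t₀, t ∈ Icc 0 b := by
    filter_upwards [self_mem_nhdsWithin,
      nhdsWithin_le_nhds (Iic_mem_nhds (lt_add_one t₀))] with t h1 h2 using ⟨h1, h2⟩
  have hgb := hg.mono_set (Ioc_subset_Icc_self.trans Icc_subset_Ici_self : Ioc 0 b ⊆ Ici 0)
  have hcont : ContinuousWithinAt (fun t => ∫ s in Ioc 0 b, F t s) (Ici 0) t₀ := by
    refine continuousWithinAt_of_dominated (bound := fun _ => M * G) ?_ ?_ (integrable_const _) ?_
    · exact Eventually.of_forall fun t =>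
        (hT.aestronglyMeasurable_extend hM hgb t).indicator measurableSet_Iic
    · refine Eventually.of_forall fun t => ?_
      filter_upwards [ae_norm_apply_le hM hG t b] with s hs
      exact (norm_indicator_le_norm_self _ _).trans hs
    · filter_upwards [(volume.restrict (Ioc 0 b)).ae_ne t₀] with s hs
      refine ContinuousAt.continuousWithinAt ?_
      rcases lt_or_gt_of_ne hs with h | h
      · have hc : ContinuousAt (fun t => T (max 0 (t - s)) (g s)) t₀ :=
          ((hT.continuous_extend hM (g s)).comp (continuous_id.sub continuous_const)).continuousAt
        refine hc.congr ?_
        filter_upwards [Ioi_mem_nhds h] with t ht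
        exact (indicator_of_mem (mem_Iic.2 (mem_Ioi.1 ht).le) fun s => T (max 0 (t - s)) (g s)).symm
      · refine (continuousAt_const (y := (0 : X))).congr ?_
        filter_upwards [Iio_mem_nhds h] with t ht
        exact (indicator_of_notMem (fun h' => not_lt.2 (mem_Iic.1 h') ht) _).symm
  exact hcont.congr_of_eventuallyEq (hev.mono fun t ht => hF t ht) (hF t₀ ⟨ht₀, by simp [b]⟩)

end Convolution

/-! ### Uniform bound for the convolution, and finite rank inputs -/

section Admissibility

variable {X : Type*} [NormedAddCommGroup X] [InnerProductSpace ℂ X]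
  {A : X →ₗ.[ℂ] X} {T : ℝ → X →L[ℂ] X} {φ : ℕ → X} {Q : X ≃L[ℂ] lp (fun _ : ℕ => ℂ) 2}
  {lam : ℕ → ℂ}

theorem integral_exp_sub_mul_le {r t : ℝ} (hr : r < 0) :
    ∫ s in (0 : ℝ)..t, Real.exp ((t - s) * r) ≤ (-r)⁻¹ := by
  have h1 : ∫ s in (0 : ℝ)..t, Real.exp ((t - s) * r) = ∫ s in (0 : ℝ)..t, Real.exp (s * r) := by
    simpa using intervalIntegral.integral_comp_sub_left (fun s => Real.exp (s * r)) t
      (a := 0) (b := t)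
  rw [h1, intervalIntegral.integral_comp_mul_right (fun s => Real.exp s) hr.ne, integral_exp]
  simp only [zero_mul, Real.exp_zero, smul_eq_mul]
  have h2 : 0 < Real.exp (t * r) := Real.exp_pos _
  have h3 : r⁻¹ < 0 := inv_lt_zero.2 hr
  rw [inv_neg]
  nlinarith

/-- Uniform bound for the convolution of a diagonal semigroup with an input whose `n`-th
coordinate is small compared with `|Re λₙ|`. -/
theorem norm_convolution_le [CompleteSpace X] (hQ : ∀ n, Q (φ n) = lp.single 2 n (1 : ℂ))
    (hlam : ∀ n, (φ n, lam n • φ n) ∈ A.graph) (hre : ∀ n, (lam n).re < 0)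
    (hA : IsGeneratorOf A T) {M : ℝ} (hM : ∀ t, 0 ≤ t → ‖T t‖ ≤ M) {g : ℝ → X} {G : ℝ}
    (hg : AEStronglyMeasurable g (volume.restrict (Ici 0)))
    (hG : ∀ᵐ s ∂volume.restrict (Ici (0 : ℝ)), ‖g s‖ ≤ G) {c : ℝ} (hc : 0 ≤ c) {z : X}
    (hz : ∀ᵐ s ∂volume.restrict (Ici (0 : ℝ)), ∀ n,
      ‖(Q (g s) : ℕ → ℂ) n‖ ≤ c * -(lam n).re * ‖(Q z : ℕ → ℂ) n‖) {t : ℝ} (ht : 0 ≤ t) :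
    ‖∫ s in (0 : ℝ)..t, T (t - s) (g s)‖ ≤ ‖(Q.symm : lp (fun _ : ℕ => ℂ) 2 →L[ℂ] X)‖ *
      ‖(Q : X →L[ℂ] lp (fun _ : ℕ => ℂ) 2)‖ * c * ‖z‖ := by
  have hint := hA.isC0Semigroup.intervalIntegrable_convolution hM hg hG ht
  refine norm_le_of_coord_le (Q := Q) hc fun n => ?_
  have hcoord : (Q (∫ s in (0 : ℝ)..t, T (t - s) (g s)) : ℕ → ℂ) n =
      ∫ s in (0 : ℝ)..t, (Q (T (t - s) (g s)) : ℕ → ℂ) n :=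
    (((lp.evalCLM ℂ (fun _ : ℕ => ℂ) 2 n).comp
      (Q : X →L[ℂ] lp (fun _ : ℕ => ℂ) 2)).intervalIntegral_comp_comm hint).symm
  rw [hcoord]
  have hr := hre n
  have hle : ∀ᵐ s, s ∈ Ioc 0 t → ‖(Q (T (t - s) (g s)) : ℕ → ℂ) n‖ ≤
      Real.exp ((t - s) * (lam n).re) * (c * -(lam n).re * ‖(Q z : ℕ → ℂ) n‖) := by
    filter_upwards [(ae_restrict_iff' measurableSet_Ici).1 hz] with s hs hst
    rw [coord_apply_of_diagonal hQ (d := fun n => Complex.exp ((t - s : ℝ) * lam n))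
      (fun n => hA.apply_eigenvector hM (hlam n) (sub_nonneg.2 hst.2)), norm_mul,
      Complex.norm_exp, Complex.re_ofReal_mul]
    gcongr
    exact hs hst.1.le n
  refine (intervalIntegral.norm_integral_le_of_norm_le ht hle
    (by apply Continuous.intervalIntegrable; fun_prop)).trans ?_
  rw [intervalIntegral.integral_mul_const]
  refine (mul_le_mul_of_nonneg_right (integral_exp_sub_mul_le hr) ?_).trans_eq ?_
  · have := neg_pos.2 hr
    positivity
  · have := hr.ne
    field_simp

variable {U : Type*} [NormedAddCommGroup U] [NormedSpace ℂ U]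

/-- A finite rank operator with range in the range of `S` factors through `S`. -/
theorem exists_lift_of_finiteDimensional_range {B : U →L[ℂ] X} {S : X →L[ℂ] X}
    (hfin : FiniteDimensional ℂ (LinearMap.range (B : U →ₗ[ℂ] X)))
    (hran : ∀ u, ∃ x, S x = B u) :
    ∃ (m : ℕ) (f : Fin m → U →L[ℂ] ℂ) (x : Fin m → X), ∀ u, B u = S (∑ i, f i u • x i) := by
  let V := LinearMap.range (B : U →ₗ[ℂ] X)
  let b := Module.finBasis ℂ V
  -- Preimages are chosen only for a basis of the range, so the coefficients remain continuous in
  -- `u`.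
  have hx : ∀ i, ∃ x, S x = (b i : X) := fun i => by
    obtain ⟨u, hu⟩ := (b i).2
    obtain ⟨x, hx⟩ := hran u
    exact ⟨x, hx.trans hu⟩
  choose x hx using hx
  let BV : U →L[ℂ] V := B.codRestrict V fun u => ⟨u, rfl⟩
  refine ⟨_, fun i => (LinearMap.toContinuousLinearMap (b.coord i)).comp BV, x, fun u => ?_⟩
  have h1 : (BV u : X) = B u := rfl
  have h2 := congrArg (Subtype.val) (b.sum_repr (BV u))
  rw [h1] at h2
  rw [← h2, map_sum]
  simp only [map_smul, hx, Submodule.coe_sum, Submodule.coe_smul]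
  rfl

/-- The coordinates of a finite sum `∑ fᵢ(u) xᵢ` have a square summable majorant. -/
theorem exists_coord_majorant {m : ℕ} (f : Fin m → U →L[ℂ] ℂ) (x : Fin m → X) :
    ∃ z : X, ∀ u n, ‖(Q (∑ i, f i u • x i) : ℕ → ℂ) n‖ ≤ ‖u‖ * ‖(Q z : ℕ → ℂ) n‖ := by
  -- A finite sum of `ℓ²` sequences, independent of `u`; `z` is the vector with these coordinates.
  let w : ℕ → ℂ := fun n => ((∑ i, ‖f i‖ * ‖(Q (x i) : ℕ → ℂ) n‖ : ℝ) : ℂ)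
  have hw : Memℓp w 2 := by
    have h1 : Memℓp (fun n => ∑ i, ‖f i‖ * ‖(Q (x i) : ℕ → ℂ) n‖) 2 :=
      Memℓp.finsetSum (E := fun _ : ℕ => ℝ) Finset.univ
        (f := fun i n => ‖f i‖ * ‖(Q (x i) : ℕ → ℂ) n‖) fun i _ =>
        (memℓp_norm_iff.2 (lp.memℓp (Q (x i)))).const_mul ‖f i‖
    exact h1.mono' fun n => (Complex.norm_real _).le
  refine ⟨Q.symm ⟨w, hw⟩, fun u n => ?_⟩
  rw [Q.apply_symm_apply]
  have h1 : (Q (∑ i, f i u • x i) : ℕ → ℂ) n = ∑ i, f i u * (Q (x i) : ℕ → ℂ) n := by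
    rw [map_sum, lp.coeFn_sum, Finset.sum_apply]
    simp
  have h2 : ‖w n‖ = ∑ i, ‖f i‖ * ‖(Q (x i) : ℕ → ℂ) n‖ :=
    Complex.norm_of_nonneg (by positivity)
  change _ ≤ ‖u‖ * ‖w n‖
  rw [h1, h2, Finset.mul_sum]
  refine (norm_sum_le _ _).trans (Finset.sum_le_sum fun i _ => ?_)
  rw [norm_mul, ← mul_assoc]
  gcongr
  rw [mul_comm]
  exact (f i).le_opNorm u

end Admissibility

end PolyISS

namespace PolyISS

/-! ### Explicit comparison functions -/

section Comparison

theorem isClassKInf_mul {c : ℝ≥0} (hc : 0 < c) : IsClassKInf fun r => c * r where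
  continuous := by fun_prop
  strictMono := fun _ _ h => mul_lt_mul_of_pos_left h hc
  map_zero := mul_zero c
  unbounded := by
    rintro ⟨b, hb⟩
    have h1 : c * ((b + 1) / c) ≤ b := hb ⟨_, rfl⟩
    rw [mul_div_cancel₀ _ hc.ne'] at h1
    exact absurd h1 (not_le.2 (lt_add_one b))

theorem isClassKL_mul_inv_rpow {c : ℝ≥0} (hc : 0 < c) {β : ℝ} (hβ : 0 < β) :
    IsClassKL fun r t => c * r * ((1 + t) ^ β)⁻¹ := by
  have hpos : ∀ t : ℝ≥0, 0 < (1 + t) ^ β := fun t => NNReal.rpow_pos (by positivity)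
  have hcont : Continuous fun t : ℝ≥0 => ((1 + t) ^ β)⁻¹ :=
    ((NNReal.continuous_rpow_const hβ.le).comp (continuous_const.add continuous_id)).inv₀
      fun t => (hpos t).ne'
  refine ⟨?_, fun t => ⟨by fun_prop, fun a b h => ?_, by simp⟩, fun r hr => ⟨?_, ?_, ?_⟩⟩
  · exact (continuous_const.mul continuous_fst).mul (hcont.comp continuous_snd)
  · have := inv_pos.2 (hpos t)
    exact mul_lt_mul_of_pos_right (mul_lt_mul_of_pos_left h hc) this
  · exact continuous_const.mul hcont
  · intro a b h
    have h1 : (1 + a) ^ β < (1 + b) ^ β := NNReal.rpow_lt_rpow (by gcongr) hβ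
    have h2 : ((1 + b) ^ β)⁻¹ < ((1 + a) ^ β)⁻¹ := (inv_lt_inv₀ (hpos b) (hpos a)).2 h1
    exact mul_lt_mul_of_pos_left h2 (mul_pos hc hr)
  · have h1 : Tendsto (fun t : ℝ≥0 => (1 + t) ^ β) atTop atTop :=
      (NNReal.tendsto_rpow_atTop hβ).comp (tendsto_atTop_mono (fun _ => le_add_self) tendsto_id)
    simpa using h1.inv_tendsto_atTop.const_mul (c * r)

end Comparison

/-! ### Mild solutions of the linear system -/

section MildSolution

variable {X : Type*} [NormedAddCommGroup X] [NormedSpace ℂ X] {T : ℝ → X →L[ℂ] X}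
  {U : Type*} [NormedAddCommGroup U] [NormedSpace ℂ U] {M : ℝ}

theorem aestronglyMeasurable_apply_input (B : U →L[ℂ] X) (u : Input U) :
    AEStronglyMeasurable (fun s => B (u s)) (volume.restrict (Ici 0)) :=
  B.continuous.comp_aestronglyMeasurable (Lp.aestronglyMeasurable u)

theorem ae_norm_apply_input_le (B : U →L[ℂ] X) (u : Input U) :
    ∀ᵐ s ∂volume.restrict (Ici (0 : ℝ)), ‖B (u s)‖ ≤ ‖B‖ * ‖u‖ := by
  filter_upwards [u.ae_norm_le] with s hs
  exact (B.le_opNorm _).trans (by gcongr)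

/-- The nonlinearity does not depend on the state, so the variation of constants formula is explicit
and uniqueness is immediate. -/
theorem isForwardComplete_linear (hT : IsC0Semigroup T) (hM : ∀ t, 0 ≤ t → ‖T t‖ ≤ M)
    (B : U →L[ℂ] X) : IsForwardComplete T fun (_ : X) (v : U) => B v := by
  intro x₀ u
  have hg := aestronglyMeasurable_apply_input B u
  have hG := ae_norm_apply_input_le B u
  refine ⟨fun t => T t x₀ + ∫ s in (0 : ℝ)..t, T (t - s) (B (u s)), ⟨?_, fun τ hτ => ?_,
    fun t _ => rfl⟩, fun y hy t ht => hy.eq t ht⟩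
  · refine ContinuousOn.add ?_ (hT.continuousOn_convolution hM hg hG)
    refine (hT.continuous_extend hM x₀).continuousOn.congr fun s hs => ?_
    simp only [max_eq_right (mem_Ici.1 hs)]
  · exact Integrable.mono' (g := fun _ => ‖B‖ * ‖u‖) (integrable_const _)
      (hg.mono_set Icc_subset_Ici_self)
      (ae_restrict_of_ae_restrict_of_subset Icc_subset_Ici_self hG)

end MildSolution

/-! ### Admissibility of `B` and the main theorem -/

section Main

variable {X : Type*} [NormedAddCommGroup X] [InnerProductSpace ℂ X] [CompleteSpace X]
  {U : Type*} [NormedAddCommGroup U] [NormedSpace ℂ U]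
  {A : X →ₗ.[ℂ] X} {T : ℝ → X →L[ℂ] X} {α : ℝ} {B : U →L[ℂ] X}

/-- Finite rank control operators with range in `D((-A)^α)` are infinite-time admissible for
bounded inputs. -/
theorem exists_norm_input_convolution_le (hA : IsDiagonalizable A) (hT : IsGeneratorOf A T)
    (hstab : IsPolynomiallyStable A T α)
    (hfin : FiniteDimensional ℂ (LinearMap.range (B : U →ₗ[ℂ] X)))
    (hran : LinearMap.range (B : U →ₗ[ℂ] X) ≤ (negPow A α).domain) :
    ∃ C : ℝ, 0 ≤ C ∧ ∀ (u : Input U) (t : ℝ), 0 ≤ t →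
      ‖∫ s in (0 : ℝ)..t, T (t - s) (B (u s))‖ ≤ C * ‖u‖ := by
  obtain ⟨M, hM⟩ := hstab.semiUniformlyStable.bounded
  obtain ⟨-, φ, ⟨Q, hQ⟩, hφ⟩ := hA
  choose hφ0 lam hlam using hφ
  obtain ⟨δ, C₁, hδ, hC₁, hev⟩ := hstab.eigenvalue_bound hT
  have hev' := fun n => hev (φ n) (lam n) (hφ0 n) (hlam n)
  obtain ⟨d, C₂, hC₂, hd, hd'⟩ := exists_symbol_negPowNeg hQ hlam (fun n => (hev' n).2.1.le) hδ
    (fun n => (hev' n).1) hstab.zero_mem hstab.pos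
  have hlift : ∀ u, ∃ x, negPowNeg A α x = B u := fun u => by
    have h1 : B u ∈ (negPow A α).domain := hran ⟨u, rfl⟩
    rw [negPow, LinearPMap.inverse_domain] at h1
    obtain ⟨x, hx⟩ := h1
    exact ⟨x, hx⟩
  obtain ⟨m, f, x, hfx⟩ := exists_lift_of_finiteDimensional_range hfin hlift
  obtain ⟨z, hz⟩ := exists_coord_majorant (Q := Q) f x
  refine ⟨‖(Q.symm : lp (fun _ : ℕ => ℂ) 2 →L[ℂ] X)‖ *
    ‖(Q : X →L[ℂ] lp (fun _ : ℕ => ℂ) 2)‖ * (C₂ * C₁) * ‖z‖, by positivity, fun u t ht => ?_⟩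
  -- `C₂` bounds the symbol by `‖lam n‖ ^ (-α)`, `C₁` bounds that power by `-Re lam n`, and `‖u‖`
  -- comes from the majorant `z`.
  refine (norm_convolution_le hQ hlam (fun n => (hev' n).2.1) hT hM
    (aestronglyMeasurable_apply_input B u) (ae_norm_apply_input_le B u) (c := C₂ * C₁ * ‖u‖)
    (by positivity) (z := z) ?_ ht).trans_eq (by ring)
  filter_upwards [u.ae_norm_le] with s hs n
  have hpos := neg_pos.2 (hev' n).2.1
  rw [hfx, coord_apply_of_diagonal hQ hd, norm_mul]
  calc ‖d n‖ * ‖(Q (∑ i, f i (u s) • x i) : ℕ → ℂ) n‖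
      ≤ (C₂ * (C₁ * -(lam n).re)) * (‖u‖ * ‖(Q z : ℕ → ℂ) n‖) := by
        refine mul_le_mul ((hd' n).trans ?_) ((hz _ n).trans ?_) (norm_nonneg _) (by positivity)
        · exact mul_le_mul_of_nonneg_left (hev' n).2.2 hC₂
        · gcongr
    _ = _ := by ring

end Main

end PolyISS

theorem mainTheorem5 {X : Type*} [NormedAddCommGroup X] [InnerProductSpace ℂ X] [CompleteSpace X]
    {U : Type*} [NormedAddCommGroup U] [NormedSpace ℂ U] [CompleteSpace U]
    (A : X →ₗ.[ℂ] X) (hA : PolyISS.IsDiagonalizable A)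
    (T : ℝ → X →L[ℂ] X) (hT : PolyISS.IsGeneratorOf A T)
    (α : ℝ) (hα : 0 < α) (hstab : PolyISS.IsPolynomiallyStable A T α)
    (B : U →L[ℂ] X) (hfin : FiniteDimensional ℂ (LinearMap.range (B : U →ₗ[ℂ] X)))
    (hran : LinearMap.range (B : U →ₗ[ℂ] X) ≤ (PolyISS.negPow A α).domain) :
    PolyISS.IsLinPolyISS A T B α := by
  obtain ⟨M, hM⟩ := hstab.semiUniformlyStable.bounded
  have hM0 : 0 ≤ M := (norm_nonneg _).trans (hM 0 le_rfl)
  obtain ⟨C, hC, hconv⟩ := PolyISS.exists_norm_input_convolution_le hA hT hstab hfin hran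
  obtain ⟨K, hK, hdecay⟩ := hstab.decay
  lift M to ℝ≥0 using hM0
  lift C to ℝ≥0 using hC
  lift K to ℝ≥0 using hK.le
  have hK' : 0 < K := by exact_mod_cast hK
  -- `C` may vanish; adding `1` makes the gain strictly increasing and unbounded. The same is done
  -- with `M` below.
  have hμ : PolyISS.IsClassKInf fun r => (C + 1) * r := PolyISS.isClassKInf_mul (by positivity)
  have hconv' : ∀ (u : PolyISS.Input U) (t : ℝ), 0 ≤ t →
      ‖∫ s in (0 : ℝ)..t, T (t - s) (B (u s))‖ ≤ (C + 1) * ‖u‖ := fun u t ht =>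
    (hconv u t ht).trans (by gcongr; exact le_add_of_nonneg_right zero_le_one)
  refine ⟨hα, ⟨PolyISS.isForwardComplete_linear hT.isC0Semigroup hM B,
    fun r => (M + 1) * r, _, PolyISS.isClassKInf_mul (by positivity), hμ,
    fun x₀ u x hx t => ?_⟩, fun r t => K * r * ((1 + t) ^ (1 / α))⁻¹, _,
    PolyISS.isClassKL_mul_inv_rpow hK' (by positivity), hμ, fun x₀ u x hx t => ?_, fun r hr => ?_⟩
  · rw [← NNReal.coe_le_coe]
    push_cast
    rw [hx.eq t t.2]
    refine (norm_add_le _ _).trans (add_le_add ?_ (hconv' u t t.2))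
    refine ((T t).le_opNorm _).trans ?_
    gcongr
    exact (hM t t.2).trans (le_add_of_nonneg_right zero_le_one)
  · rw [← NNReal.coe_le_coe]
    push_cast
    rw [hx.eq t t.2, ← Real.rpow_neg (by positivity)]
    exact (norm_add_le _ _).trans (add_le_add (hdecay x₀ t t.2) (hconv' u t t.2))
  · refine IsBigO.of_bound (K * r) ?_
    filter_upwards [eventually_gt_atTop 0] with t ht
    have ht' : (0 : ℝ) < t := by exact_mod_cast ht
    push_cast
    rw [Real.norm_of_nonneg (by positivity), Real.norm_of_nonneg (by positivity),
      Real.rpow_neg ht'.le]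
    gcongr
    exact le_add_of_nonneg_left zero_le_one
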